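/- Let $\mathbb{F}_q$ be a finite field, let $F_1\subsetneq F_0\subseteq\mathbb{F}_q^n$ be linear codes, and let $u,v\ge 0$, $e=u+v$. Let $G_E\in\mathbb{F}_q^{e\times n}$ be a matrix (not necessarily of full rank) whose row space $E$ satisfies $F_0\cap E=\{0\}$. Let $U$ be the row space of the first $u$ rows of $G_E$ and $V$ the row space of its last $v$ rows. Let $G_{F_1}$ be a generator matrix of $F_1$, with $f_1=\dim F_1$ rows, and $G_{F_0/F_1}$ a generator matrix of a complement of $F_1$ in $F_0$, with $m=\dim F_0-\dim F_1$ rows. In the QSS scheme from the extended CSS code $\mathrm{ECSS}(F_0,F_1,G_E)$, a secret of $m$ qudits of dimension $q$ is encoded into $n+e$ qudits, one for each of the parties $1,\dots,n+e$, by the linear map $$|s\rangle\ \mapsto\ \frac{1}{\sqrt{q^{f_1+e}}}\sum_{r_1\in\mathbb{F}_q^{f_1},\ r_2\in\mathbb{F}_q^{e}}\bigl|\,G_{F_0/F_1}^{T}s+G_{F_1}^{T}r_1+G_E^{T}r_2\bigr\rangle\,|r_2\rangle,\qquad s\in\mathbb{F}_q^{m}.$$ A set of parties is authorized if some quantum channel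 acting only on the qudits of these parties recovers every state of the secret. **Theorem (Threshold with prior access to extension qudits).** Let $\tau\ge 0$ be an integer. The set $J\cup\{n+1,n+2,\dots,n+u\}$ is authorized for every $J\subseteq[n]$ with $|J|=\tau$ if and only if $\tau\ge\tau_u$, where $$\tau_u=n-\min\bigl\{\mathrm{wt}\bigl((F_0+V)\setminus(F_1+V)\bigr),\ \mathrm{wt}\bigl((F_1+U)^\perp\setminus(F_0+U)^\perp\bigr)\bigr\}+1.$$ Here $\mathrm{wt}(A\setminus B)$ is the least Hamming weight of a word of $A$ that does not lie in $B$, and $C^\perp=\{x\in\mathbb{F}_q^n : \sum_i x_ic_i=0 \text{ for all } c\in C\}$. -/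

import Mathlib

open Matrix
open scoped ComplexOrder

/-! ## Linear codes -/

/-- The row space of a matrix, i.e. the linear code spanned by its rows. -/
def rowSpan {F κ ι : Type*} [Field F] (G : Matrix κ ι F) : Submodule F (ι → F) :=
  Submodule.span F (Set.range G.row)

/-- `G` is a generator matrix of the linear code `C`: its rows form a basis of `C`. -/
def IsGeneratorMatrix {F κ ι : Type*} [Field F] (G : Matrix κ ι F)
    (C : Submodule F (ι → F)) : Prop :=
  LinearIndependent F G.row ∧ rowSpan G = C

/-- `G` is a generator matrix of some complement of `C₁` in `C₀`
(the matrix usually written `G_{C₀/C₁}`). -/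
def IsQuotientGeneratorMatrix {F κ ι : Type*} [Field F] (G : Matrix κ ι F)
    (C₀ C₁ : Submodule F (ι → F)) : Prop :=
  ∃ W : Submodule F (ι → F), IsGeneratorMatrix G W ∧ W ⊓ C₁ = ⊥ ∧ W ⊔ C₁ = C₀

/-- The dual code with respect to the standard bilinear form. -/
def dualCode {F ι : Type*} [Field F] [Fintype ι] (C : Submodule F (ι → F)) :
    Submodule F (ι → F) where
  carrier := {x | ∀ c ∈ C, x ⬝ᵥ c = 0}
  zero_mem' := fun c _ => zero_dotProduct c
  add_mem' := fun {x y} hx hy c hc => by rw [add_dotProduct, hx c hc, hy c hc, add_zero]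
  smul_mem' := fun a x hx c hc => by rw [smul_dotProduct, hx c hc, smul_zero]

/-- The minimum distance `wt(C₀ ∖ C₁)` of a pair of codes: the least Hamming weight of a word
that lies in `C₀` but not in `C₁`. -/
noncomputable def relMinDist {F ι : Type*} [Field F] [DecidableEq F] [Fintype ι]
    (C₀ C₁ : Submodule F (ι → F)) : ℕ :=
  sInf {w : ℕ | ∃ c ∈ C₀, c ∉ C₁ ∧ hammingNorm c = w}

/-- The minimum is attained as soon as some word of `C₀` lies outside `C₁`. -/
theorem relMinDist_isLeast {F ι : Type*} [Field F] [DecidableEq F] [Fintype ι]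
    {C₀ C₁ : Submodule F (ι → F)} (h : ¬ C₀ ≤ C₁) :
    IsLeast {w : ℕ | ∃ c ∈ C₀, c ∉ C₁ ∧ hammingNorm c = w} (relMinDist C₀ C₁) := by
  obtain ⟨c, hc, hc'⟩ := SetLike.not_le_iff_exists.mp h
  exact ⟨Nat.sInf_mem ⟨_, c, hc, hc', rfl⟩, fun _ hw => Nat.sInf_le hw⟩

/-! ## Quantum states, channels and secret sharing

The state space of qudits labelled by a finite type `P`, each with computational basis indexed
by `F`, is the space of functions `(P → F) → ℂ`; operators on it are complex matrices indexed by
`P → F`. -/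

/-- Density operators: positive semidefinite matrices of trace one. -/
def IsDensityMatrix {a : Type*} [Fintype a] (ρ : Matrix a a ℂ) : Prop :=
  ρ.PosSemidef ∧ ρ.trace = 1

/-- Quantum channels (completely positive trace-preserving maps), in operator-sum form. -/
def IsQuantumChannel {a b : Type*} [Fintype a] [DecidableEq a] [Fintype b]
    (Φ : Matrix a a ℂ → Matrix b b ℂ) : Prop :=
  ∃ (r : ℕ) (K : Fin r → Matrix b a ℂ),
    ∑ i, (K i)ᴴ * K i = 1 ∧ ∀ X, Φ X = ∑ i, K i * X * (K i)ᴴ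

/-- The reduced operator on the qudits in `A`: the qudits outside `A` are traced out. -/
def reducedState {P F : Type*} [Fintype P] [DecidableEq P] [Fintype F] (A : Finset P)
    (ρ : Matrix (P → F) (P → F) ℂ) :
    Matrix ({p // p ∈ A} → F) ({p // p ∈ A} → F) ℂ :=
  Matrix.of fun x y => ∑ z : {p // ¬ p ∈ A} → F,
    ρ ((Equiv.piEquivPiSubtypeProd (fun p => p ∈ A) (fun _ => F)).symm (x, z))
      ((Equiv.piEquivPiSubtypeProd (fun p => p ∈ A) (fun _ => F)).symm (y, z))

/-- Let a quantum secret with computational basis indexed by `S` be encoded by the linear map `V`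
into qudits labelled by `P`, one for each party.  The set `A` of parties is authorized if some
quantum channel acting on the qudits of the parties in `A` alone recovers every secret state. -/
def IsAuthorized {P F S : Type*} [Fintype P] [DecidableEq P] [Fintype F] [DecidableEq F]
    [Fintype S] (V : Matrix (P → F) S ℂ) (A : Finset P) : Prop :=
  ∃ R : Matrix ({p // p ∈ A} → F) ({p // p ∈ A} → F) ℂ → Matrix S S ℂ,
    IsQuantumChannel R ∧
      ∀ ρ : Matrix S S ℂ, IsDensityMatrix ρ → R (reducedState A (V * ρ * Vᴴ)) = ρ

/-! ## CSS codes and extended CSS codes -/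

/-- The CSS encoding `|s⟩ ↦ |F|^{-k₁/2} ∑_r |[D; G]ᵀ (s, r)⟩`, where `D` generates a complement of
`C₁` in `C₀`, `G` generates `C₁`, and `k₁` is the number of rows of `G`.
The entry in row `x` and column `s` is the amplitude of `|x⟩` in the encoding of `|s⟩`. -/
noncomputable def cssEncoder {F ι κ₀ κ₁ : Type*} [Field F] [Fintype F] [DecidableEq F]
    [Fintype ι] [Fintype κ₀] [Fintype κ₁] [DecidableEq κ₁]
    (D : Matrix κ₀ ι F) (G : Matrix κ₁ ι F) : Matrix (ι → F) (κ₀ → F) ℂ :=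
  Matrix.of fun x s =>
    ((Real.sqrt ((Fintype.card F : ℝ) ^ Fintype.card κ₁) : ℝ) : ℂ)⁻¹ *
      ∑ r : κ₁ → F, if x = (fromRows D G)ᵀ *ᵥ Sum.elim s r then 1 else 0

/-- The encoding in the extended CSS code `ECSS(F₀, F₁, G_E)`, where `D` generates a complement
of `F₁` in `F₀` and `G` generates `F₁`.  It is the CSS encoding for the code `C₁` generated by
`[G 0; G_E I]` and the complement generated by `[D 0]`.  The original qudits are labelled by `ι`
and the extension qudits by `ε`. -/
noncomputable def ecssEncoder {F ι ε κ₀ κ₁ : Type*} [Field F] [Fintype F] [DecidableEq F]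
    [Fintype ι] [Fintype ε] [DecidableEq ε] [Fintype κ₀] [Fintype κ₁] [DecidableEq κ₁]
    (D : Matrix κ₀ ι F) (G : Matrix κ₁ ι F) (GE : Matrix ε ι F) :
    Matrix (ι ⊕ ε → F) (κ₀ → F) ℂ :=
  cssEncoder (fromCols D (0 : Matrix κ₀ ε F)) (fromBlocks G 0 GE 1)

/-- The set of parties `J ∪ {n+1, …, n+u}`: the original parties in `J` together with the first
`u` of the `u + v` extension parties. -/
def withExtension {n u v : ℕ} (J : Finset (Fin n)) : Finset (Fin n ⊕ (Fin u ⊕ Fin v)) :=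
  J.disjSum (Finset.univ.disjSum ∅)

/-- The threshold
`τ_u = n - min {wt((F₀+V) ∖ (F₁+V)), wt((F₁+U)^⊥ ∖ (F₀+U)^⊥)} + 1`. -/
noncomputable def ecssThreshold {F : Type*} [Field F] [DecidableEq F] {n : ℕ}
    (F₀ F₁ U V : Submodule F (Fin n → F)) : ℤ :=
  (n : ℤ) - (min (relMinDist (F₀ ⊔ V) (F₁ ⊔ V))
    (relMinDist (dualCode (F₁ ⊔ U)) (dualCode (F₀ ⊔ U))) : ℕ) + 1

/-! Recovery from `A` composed with erasure of the other qudits must be the identity channel, whose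
Kraus operators are scalars. Hence the slices `V_z` of the encoder satisfy the Knill–Laflamme
relations: every `V_zᴴ V_z'` is scalar (`IsAuthorized.encoderSlice_mul_scalar`). CSS amplitudes are
nonnegative, so nothing cancels, and these relations become statements about codewords `sD + rG`:
(bit) one vanishing on `A` has `s = 0`; (phase) every `s` admits an `r` for which it vanishes off
`A`. Conversely, the two conditions yield an explicit linear decoder
(`isAuthorized_cssEncoder_iff`).

In an ECSS code the extension coordinates of a codeword display `r₂ = (a, b)`. Holding the first `u`
of them forces `a = 0` in the bit condition and leaves `b` free, which produces `F₀ + V` and `F₁ +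
V`; the phase condition forces `b = 0` and leaves `a` free, which produces `U` and, after dualizing,
the second pair of codes. Each condition, over all `J` of size `τ`, says that `n - τ` is below a
relative minimum distance. -/

/-! ## Slices of an encoder and Kraus operators of the identity channel -/

/-- Gluing a word on the parties in `A` and a word on the other parties. -/
def glue {P F : Type*} [DecidableEq P] (A : Finset P)
    (x : {p // p ∈ A} → F) (z : {p // ¬ p ∈ A} → F) : P → F :=
  (Equiv.piEquivPiSubtypeProd (fun p => p ∈ A) (fun _ => F)).symm (x, z)

/-- The part of the encoder `V` in which the qudits outside `A` are in the basis state `z`. -/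
def encoderSlice {P F S : Type*} [DecidableEq P] (V : Matrix (P → F) S ℂ) (A : Finset P)
    (z : {p // ¬ p ∈ A} → F) : Matrix ({p // p ∈ A} → F) S ℂ :=
  Matrix.of fun x s => V (glue A x z) s

theorem glue_eq_iff {P F : Type*} [DecidableEq P] {A : Finset P}
    {x : {p // p ∈ A} → F} {z : {p // ¬ p ∈ A} → F} {w : P → F} :
    glue A x z = w ↔ (x = fun p => w p.1) ∧ (z = fun p => w p.1) := by
  unfold glue
  rw [Equiv.symm_apply_eq]
  simp [Equiv.piEquivPiSubtypeProd, Prod.ext_iff]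

/-- The slices are the Kraus operators of encoding followed by loss of the qudits outside `A`. -/
theorem reducedState_conj_eq_sum {P F S : Type*} [Fintype P] [DecidableEq P] [Fintype F]
    [Fintype S] (V : Matrix (P → F) S ℂ) (A : Finset P) (ρ : Matrix S S ℂ) :
    reducedState A (V * ρ * Vᴴ) =
      ∑ z, encoderSlice V A z * ρ * (encoderSlice V A z)ᴴ := by
  ext x y
  simp only [reducedState, Matrix.of_apply, Matrix.sum_apply]
  rfl

theorem isDensityMatrix_vecMulVec {S : Type*} [Fintype S] (ψ : S → ℂ)
    (h : ∑ s, ψ s * star (ψ s) = 1) : IsDensityMatrix (vecMulVec ψ (star ψ)) :=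
  ⟨posSemidef_vecMulVec_self_star ψ, by simpa [Matrix.trace, vecMulVec_apply] using h⟩

theorem mul_vecMulVec_star_mul_conjTranspose_apply {S : Type*} [Fintype S]
    (W : Matrix S S ℂ) (ψ : S → ℂ) (a b : S) :
    (W * vecMulVec ψ (star ψ) * Wᴴ) a b = (W *ᵥ ψ) a * star ((W *ᵥ ψ) b) := by
  rw [mul_vecMulVec, vecMulVec_mul, ← star_mulVec, vecMulVec_apply, Pi.star_apply]

/-- The Kraus operators of the identity channel are scalar matrices. -/
theorem kraus_of_identity_scalar {S I : Type*} [Fintype S] [DecidableEq S] [Fintype I]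
    (W : I → Matrix S S ℂ)
    (h : ∀ ρ : Matrix S S ℂ, IsDensityMatrix ρ → ∑ i, W i * ρ * (W i)ᴴ = ρ) (i : I) :
    ∃ c : ℂ, W i = c • (1 : Matrix S S ℂ) := by
  have hpure : ∀ ψ : S → ℂ, ∑ s, ψ s * star (ψ s) = 1 → ∀ a b,
      ∑ i, (W i *ᵥ ψ) a * star ((W i *ᵥ ψ) b) = ψ a * star (ψ b) := by
    intro ψ hψ a b
    have := congrFun (congrFun (h _ (isDensityMatrix_vecMulVec ψ hψ)) a) b
    simpa only [Matrix.sum_apply, mul_vecMulVec_star_mul_conjTranspose_apply, vecMulVec_apply,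
      Pi.star_apply] using this
  have hzero : ∀ f : I → ℂ, ∑ i, f i * star (f i) = 0 → ∀ i, f i = 0 := by
    intro f hf i
    have := (Finset.sum_eq_zero_iff_of_nonneg
      (fun i _ => mul_star_self_nonneg (f i))).1 hf i (Finset.mem_univ i)
    simpa using this
  have hsingle : ∀ s a b, ∑ i, W i a s * star (W i b s) =
      (Pi.single s 1 : S → ℂ) a * star ((Pi.single s 1 : S → ℂ) b) := by
    intro s a b
    have := hpure (Pi.single s 1) (by simp [Pi.single_apply]) a b
    simpa using this
  -- On the basis state `s`, the diagonal entry at `t ≠ s` is a vanishing sum of squared moduli.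
  have hoff : ∀ i s t, t ≠ s → W i t s = 0 := fun i s t hts =>
    hzero (fun i => W i t s) (by rw [hsingle]; simp [hts]) i
  have hdiag : ∀ s, ∑ i, W i s s * star (W i s s) = 1 := fun s => by
    rw [hsingle]; simp
  -- Coherence: compare the `(s, t)` entries for the state `(|s⟩ + |t⟩)/√2`.
  have hcross : ∀ s t, t ≠ s → ∑ i, W i s s * star (W i t t) = 1 := by
    intro s t hts
    set c : ℂ := (((Real.sqrt 2)⁻¹ : ℝ) : ℂ) with hc
    have hcc : c * star c = 1 / 2 := by
      rw [hc, Complex.star_def, Complex.conj_ofReal, ← Complex.ofReal_mul, ← mul_inv,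
        Real.mul_self_sqrt (by norm_num)]
      norm_num
    have hψ : ∀ i a, (W i *ᵥ (Pi.single s c + Pi.single t c)) a = (W i a s + W i a t) * c := by
      intro i a
      rw [mulVec_add]
      simp [mul_comm c, add_mul]
    have hn : ∑ a, (Pi.single s c + Pi.single t c : S → ℂ) a *
        star ((Pi.single s c + Pi.single t c : S → ℂ) a) = 1 := by
      have : ∀ a, (Pi.single s c + Pi.single t c : S → ℂ) a *
          star ((Pi.single s c + Pi.single t c : S → ℂ) a) =
          (if a = s then 1 / 2 else 0) + (if a = t then 1 / 2 else 0) := by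
        intro a
        rw [← hcc]
        by_cases has : a = s
        · have : a ≠ t := fun h => hts (h.symm.trans has)
          subst has
          simp [this]
        · by_cases hat : a = t
          · subst hat
            simp [has]
          · simp [has, hat]
      simp only [this, Finset.sum_add_distrib, Finset.sum_ite_eq', Finset.mem_univ, if_true]
      norm_num
    have h1 := hpure _ hn s t
    simp only [hψ, hoff _ _ _ hts, hoff _ _ _ hts.symm, add_zero, zero_add, star_mul'] at h1
    have h2 : ∀ i, W i s s * c * (star (W i t t) * star c) =
        (1 / 2) * (W i s s * star (W i t t)) := by
      intro i; rw [← hcc]; ring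
    simp only [h2, ← Finset.mul_sum] at h1
    simp [hts, hts.symm] at h1
    have h3 : c * (starRingEnd ℂ) c = 1 / 2 := hcc
    rw [h3] at h1
    have := mul_left_cancel₀ (by norm_num : (2⁻¹ : ℂ) ≠ 0) (h1.trans (by norm_num : _ = 2⁻¹ * (1:ℂ)))
    simpa using this
  have heq : ∀ i s t, W i s s = W i t t := by
    intro i s t
    by_cases hts : t = s
    · rw [hts]
    -- The squared moduli of these differences sum to `1 - 1 - 1 + 1 = 0`.
    refine sub_eq_zero.1 (hzero (fun i => W i s s - W i t t) ?_ i)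
    have : ∀ i, (W i s s - W i t t) * star (W i s s - W i t t) =
        W i s s * star (W i s s) - W i s s * star (W i t t) - W i t t * star (W i s s)
          + W i t t * star (W i t t) := by
      intro i; rw [star_sub]; ring
    simp only [this, Finset.sum_add_distrib, Finset.sum_sub_distrib, hdiag, hcross s t hts,
      hcross t s (Ne.symm hts)]
    ring
  by_cases hS : Nonempty S
  · obtain ⟨s₀⟩ := hS
    refine ⟨W i s₀ s₀, ?_⟩
    ext a b
    by_cases hab : a = b
    · subst hab; simpa using heq i a s₀
    · simp [hab, hoff i b a hab]
  · exact ⟨0, by ext a; exact absurd ⟨a⟩ hS⟩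

/-- If `A` is authorized, then no information on the secret can be found outside `A`. -/
theorem IsAuthorized.encoderSlice_mul_scalar {P F S : Type*} [Fintype P] [DecidableEq P]
    [Fintype F] [DecidableEq F] [Fintype S] [DecidableEq S] {V : Matrix (P → F) S ℂ} {A : Finset P}
    (h : IsAuthorized V A) (z z' : {p // ¬ p ∈ A} → F) :
    ∃ c : ℂ, (encoderSlice V A z)ᴴ * encoderSlice V A z' = c • (1 : Matrix S S ℂ) := by
  obtain ⟨R, ⟨r, K, hK, hR⟩, hrec⟩ := h
  have hsc := kraus_of_identity_scalar
    (fun k : Fin r × ({p // ¬ p ∈ A} → F) => K k.1 * encoderSlice V A k.2) (by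
      intro ρ hρ
      conv_rhs => rw [← hrec ρ hρ, hR, reducedState_conj_eq_sum]
      rw [Fintype.sum_prod_type]
      simp only [Matrix.mul_sum, Matrix.sum_mul, conjTranspose_mul, Matrix.mul_assoc])
  choose l hl using fun i z => hsc (i, z)
  refine ⟨∑ i, star (l i z) * l i z', ?_⟩
  calc (encoderSlice V A z)ᴴ * encoderSlice V A z'
      = ∑ i, (K i * encoderSlice V A z)ᴴ * (K i * encoderSlice V A z') := by
        conv_lhs => rw [← Matrix.one_mul (encoderSlice V A z'), ← hK]
        simp only [Matrix.mul_sum, Matrix.sum_mul, conjTranspose_mul, Matrix.mul_assoc]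
    _ = _ := by
        have : ∀ i z, K i * encoderSlice V A z = l i z • (1 : Matrix S S ℂ) := fun i z => hl i z
        simp only [this, conjTranspose_smul, conjTranspose_one, smul_mul_smul_comm, Matrix.one_mul,
          Finset.sum_smul]

/-- A sufficient condition for being authorized. -/
theorem isAuthorized_of_kraus {P F S Y : Type*} [Fintype P] [DecidableEq P]
    [Fintype F] [DecidableEq F] [Fintype S] [DecidableEq S] [Fintype Y]
    {V : Matrix (P → F) S ℂ} {A : Finset P}
    (K : Y → Matrix S ({p // p ∈ A} → F) ℂ) (hK : ∑ y, (K y)ᴴ * K y = 1)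
    (l : Y → ({p // ¬ p ∈ A} → F) → ℂ)
    (hl : ∀ y z, K y * encoderSlice V A z = l y z • (1 : Matrix S S ℂ))
    (hsum : ∑ y, ∑ z, l y z * star (l y z) = 1) : IsAuthorized V A := by
  refine ⟨fun X => ∑ y, K y * X * (K y)ᴴ,
    ⟨Fintype.card Y, fun i => K ((Fintype.equivFin Y).symm i), ?_, fun X => ?_⟩, fun ρ _ => ?_⟩
  · rw [← hK]
    exact Equiv.sum_comp (Fintype.equivFin Y).symm (fun y => (K y)ᴴ * K y)
  · exact (Equiv.sum_comp (Fintype.equivFin Y).symm (fun y => K y * X * (K y)ᴴ)).symm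
  · have : ∀ y z, K y * (encoderSlice V A z * ρ * (encoderSlice V A z)ᴴ) * (K y)ᴴ =
        (l y z * star (l y z)) • ρ := by
      intro y z
      calc _ = (K y * encoderSlice V A z) * ρ * (K y * encoderSlice V A z)ᴴ := by
            simp only [conjTranspose_mul, Matrix.mul_assoc]
        _ = _ := by
            rw [hl, conjTranspose_smul, conjTranspose_one, smul_mul, Matrix.one_mul,
              Matrix.mul_smul, Matrix.mul_one, smul_smul, mul_comm]
    simp only [reducedState_conj_eq_sum, Matrix.mul_sum, Matrix.sum_mul, this, ← Finset.sum_smul,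
      hsum, one_smul]

/-! ## Authorized sets of CSS codes -/

/-- Lets the correction `r` in the phase condition be chosen linearly in `s`. -/
theorem LinearMap.exists_add_comp_eq_zero {K V S R : Type*} [Field K] [AddCommGroup V] [Module K V]
    [AddCommGroup S] [Module K S] [AddCommGroup R] [Module K R] (d : S →ₗ[K] V) (g : R →ₗ[K] V)
    (h : ∀ s, ∃ r, d s + g r = 0) : ∃ l : S →ₗ[K] R, ∀ s, d s + g (l s) = 0 := by
  have hr : ∀ s, (-d) s ∈ LinearMap.range g := fun s => by
    obtain ⟨r, hr⟩ := h s
    exact ⟨r, eq_neg_of_add_eq_zero_right hr⟩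
  obtain ⟨l, hl⟩ := Module.projective_lifting_property g.rangeRestrict
    ((-d).codRestrict (LinearMap.range g) hr) g.surjective_rangeRestrict
  refine ⟨l, fun s => ?_⟩
  have := congrArg Subtype.val (LinearMap.congr_fun hl s)
  have h2 : g (l s) = -d s := this
  rw [h2, add_neg_cancel]

theorem LinearMap.exists_comp_eq_of_ker_le {K M V S : Type*} [Field K] [AddCommGroup M] [Module K M]
    [AddCommGroup V] [Module K V] [AddCommGroup S] [Module K S] (f : M →ₗ[K] V) (h : M →ₗ[K] S)
    (hk : ∀ x, f x = 0 → h x = 0) : ∃ T : V →ₗ[K] S, ∀ x, T (f x) = h x := by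
  obtain ⟨σ, hσ⟩ := f.rangeRestrict.exists_rightInverse_of_surjective f.range_rangeRestrict
  obtain ⟨T, hT⟩ := LinearMap.exists_extend (h ∘ₗ σ)
  refine ⟨T, fun x => ?_⟩
  have h1 : T (f x) = h (σ (f.rangeRestrict x)) := LinearMap.congr_fun hT (f.rangeRestrict x)
  have h2 : f (σ (f.rangeRestrict x)) = f x :=
    congrArg Subtype.val (LinearMap.congr_fun hσ (f.rangeRestrict x))
  rw [h1, ← sub_eq_zero, ← map_sub]
  apply hk
  rw [map_sub, h2, sub_self]

section
variable {F P κ₀ κ₁ : Type*} [Field F] [Fintype F] [DecidableEq F] [Fintype P]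
  [Fintype κ₀] [Fintype κ₁] [DecidableEq κ₁]
  {D : Matrix κ₀ P F} {G : Matrix κ₁ P F}

theorem cssEncoder_apply (D : Matrix κ₀ P F) (G : Matrix κ₁ P F) (x : P → F) (s : κ₀ → F) :
    cssEncoder D G x s = ((Real.sqrt ((Fintype.card F : ℝ) ^ Fintype.card κ₁) : ℝ) : ℂ)⁻¹ *
      ∑ r : κ₁ → F, if x = s ᵥ* D + r ᵥ* G then 1 else 0 := by
  simp only [cssEncoder, Matrix.of_apply, mulVec_transpose, sumElim_vecMul_fromRows]

theorem cssEncoder_nonneg (x : P → F) (s : κ₀ → F) : 0 ≤ cssEncoder D G x s := by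
  rw [cssEncoder_apply, ← Complex.ofReal_inv]
  refine mul_nonneg (Complex.zero_le_real.2 (by positivity)) (Finset.sum_nonneg fun r _ => ?_)
  split_ifs <;> simp

theorem cssEncoder_ne_zero_iff (x : P → F) (s : κ₀ → F) :
    cssEncoder D G x s ≠ 0 ↔ ∃ r, x = s ᵥ* D + r ᵥ* G := by
  have hc : ((Real.sqrt ((Fintype.card F : ℝ) ^ Fintype.card κ₁) : ℝ) : ℂ)⁻¹ ≠ 0 := by
    have : (0 : ℝ) < Fintype.card F := by exact_mod_cast Fintype.card_pos
    have : (0 : ℝ) < Real.sqrt ((Fintype.card F : ℝ) ^ Fintype.card κ₁) := by positivity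
    exact inv_ne_zero (Complex.ofReal_ne_zero.2 this.ne')
  rw [cssEncoder_apply, Ne, mul_eq_zero, not_or, and_iff_right hc,
    Finset.sum_eq_zero_iff_of_nonneg (fun r _ => by split_ifs <;> simp)]
  simp

variable [DecidableEq P]

/-- A sum of nonnegative products is nonzero exactly when some term is, so only the supports matter.
-/
theorem encoderSlice_cssEncoder_mul_ne_zero_iff {A : Finset P} (z z' : {p // ¬ p ∈ A} → F)
    (s t : κ₀ → F) :
    ((encoderSlice (cssEncoder D G) A z)ᴴ * encoderSlice (cssEncoder D G) A z') s t ≠ 0 ↔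
      ∃ x, (∃ r, glue A x z = s ᵥ* D + r ᵥ* G) ∧ ∃ r, glue A x z' = t ᵥ* D + r ᵥ* G := by
  simp only [← cssEncoder_ne_zero_iff, Matrix.mul_apply, conjTranspose_apply, encoderSlice,
    Matrix.of_apply]
  rw [Ne, Finset.sum_eq_zero_iff_of_nonneg (fun x _ =>
    mul_nonneg (star_nonneg_iff.2 (cssEncoder_nonneg _ _)) (cssEncoder_nonneg _ _))]
  simp [not_or]

variable [DecidableEq κ₀]

theorem IsAuthorized.cssEncoder_conditions {A : Finset P}
    (h : IsAuthorized (cssEncoder D G) A) :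
    (∀ s r, (∀ p ∈ A, (s ᵥ* D + r ᵥ* G) p = 0) → s = 0) ∧
      ∀ s, ∃ r, ∀ p ∉ A, (s ᵥ* D + r ᵥ* G) p = 0 := by
  constructor
  · intro s r hsr
    by_contra hs
    -- This word and the zero word agree on `A`, so their slices overlap at `x = 0`, giving a
    -- nonzero off-diagonal entry `(s, 0)`.
    obtain ⟨c, hc⟩ := h.encoderSlice_mul_scalar (fun p => (s ᵥ* D + r ᵥ* G) p.1) 0
    refine (encoderSlice_cssEncoder_mul_ne_zero_iff _ 0 s 0).2
      ⟨0, ⟨r, glue_eq_iff.2 ⟨?_, rfl⟩⟩, 0, glue_eq_iff.2 ⟨?_, ?_⟩⟩ ((congrFun₂ hc s 0).trans ?_)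
    · ext p; exact (hsr p.1 p.2).symm
    · ext p; simp
    · ext p; simp
    · simp [hs]
  · intro s
    obtain ⟨c, hc⟩ := h.encoderSlice_mul_scalar 0 0
    -- The zero word makes the `(0, 0)` entry nonzero; in a scalar matrix the `(s, s)` entry is then
    -- nonzero too.
    have h0 := (encoderSlice_cssEncoder_mul_ne_zero_iff (D := D) (G := G) (A := A) 0 0 0 0).2
      ⟨0, ⟨0, glue_eq_iff.2 ⟨by ext p; simp, by ext p; simp⟩⟩,
        0, glue_eq_iff.2 ⟨by ext p; simp, by ext p; simp⟩⟩
    have hs : ((encoderSlice (cssEncoder D G) A 0)ᴴ * encoderSlice (cssEncoder D G) A 0) s s ≠ 0 := by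
      rw [hc] at h0 ⊢
      simpa using h0
    obtain ⟨x, ⟨r, hr⟩, -⟩ := (encoderSlice_cssEncoder_mul_ne_zero_iff _ _ _ _).1 hs
    exact ⟨r, fun p hp => (congrFun (glue_eq_iff.1 hr).2 ⟨p, hp⟩).symm⟩

theorem isAuthorized_cssEncoder (hG : Function.Injective fun r : κ₁ → F => r ᵥ* G) {A : Finset P}
    (hX : ∀ s r, (∀ p ∈ A, (s ᵥ* D + r ᵥ* G) p = 0) → s = 0)
    (hZ : ∀ s, ∃ r, ∀ p ∉ A, (s ᵥ* D + r ᵥ* G) p = 0) :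
    IsAuthorized (cssEncoder D G) A := by
  obtain ⟨l, hl⟩ := LinearMap.exists_add_comp_eq_zero
    (LinearMap.funLeft F F (Subtype.val : {p // ¬ p ∈ A} → P) ∘ₗ D.vecMulLinear)
    (LinearMap.funLeft F F (Subtype.val : {p // ¬ p ∈ A} → P) ∘ₗ G.vecMulLinear) (fun s => by
      obtain ⟨r, hr⟩ := hZ s
      exact ⟨r, funext fun p => hr p.1 p.2⟩)
  have hout : ∀ s, ∀ p ∉ A, (s ᵥ* D + l s ᵥ* G) p = 0 := fun s p hp => congrFun (hl s) ⟨p, hp⟩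
  set π := LinearMap.funLeft F F (Subtype.val : {p // p ∈ A} → P)
  set d : (κ₀ → F) →ₗ[F] ({p // p ∈ A} → F) :=
    π ∘ₗ (D.vecMulLinear + G.vecMulLinear ∘ₗ l)
  -- `T` reads the secret off the coordinates in `A`; the bit condition is what makes it well
  -- defined.
  obtain ⟨T, hT⟩ := LinearMap.exists_comp_eq_of_ker_le
    (d.coprod (π ∘ₗ G.vecMulLinear)) (LinearMap.fst F (κ₀ → F) (κ₁ → F)) (by
      rintro ⟨s, r⟩ hsr
      refine hX s (l s + r) fun p hp => ?_
      have := congrFun hsr ⟨p, hp⟩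
      rw [add_vecMul, ← add_assoc]
      exact this)
  have hTd : ∀ s, T (d s) = s := fun s => by simpa using hT (s, 0)
  have hTg : ∀ r, T (π (r ᵥ* G)) = 0 := fun r => by simpa using hT (0, r)
  set c : ℂ := ((Real.sqrt ((Fintype.card F : ℝ) ^ Fintype.card κ₁) : ℝ) : ℂ)⁻¹ with hc
  have hcc : c * star c * (Fintype.card (κ₁ → F) : ℂ) = 1 := by
    have h0 : (0 : ℝ) < Fintype.card F := by exact_mod_cast Fintype.card_pos
    rw [hc, ← Complex.ofReal_inv, Complex.star_def, Complex.conj_ofReal, ← Complex.ofReal_mul,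
      ← mul_inv, Real.mul_self_sqrt (by positivity), Fintype.card_fun]
    push_cast
    exact inv_mul_cancel₀ (pow_ne_zero _ (by exact_mod_cast h0.ne'))
  have hslice : ∀ x z s, encoderSlice (cssEncoder D G) A z x s =
      c * ∑ r : κ₁ → F, if x = d s + π (r ᵥ* G) ∧ z = (fun p => (r ᵥ* G) p.1) then 1 else 0 := by
    intro x z s
    -- Shifting `r` by `l s` moves all dependence on `s` into `A`.
    rw [encoderSlice, Matrix.of_apply, cssEncoder_apply, ← Equiv.sum_comp (Equiv.addLeft (l s))]
    congr 1
    refine Finset.sum_congr rfl fun r _ => if_congr ?_ rfl rfl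
    rw [glue_eq_iff, Equiv.coe_addLeft, add_vecMul, ← add_assoc]
    have : (fun p : {p // ¬ p ∈ A} => (s ᵥ* D + l s ᵥ* G + r ᵥ* G) p.1) =
        fun p => (r ᵥ* G) p.1 := by
      ext p
      rw [Pi.add_apply, hout s p.1 p.2, zero_add]
    rw [this]
    rfl
  refine isAuthorized_of_kraus
    -- The decoder is the bijective relabelling `x ↦ (T x, x - d (T x))` onto its image, followed by
    -- discarding `y`. What is left beside the secret is the encoding of `0`, which gives the
    -- scalars below.
    (fun y => Matrix.of fun s x => if s = T x ∧ y = x - d (T x) then 1 else 0) ?_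
    (fun y z => c * ∑ r : κ₁ → F, if glue A y z = r ᵥ* G then 1 else 0) ?_ ?_
  · ext x x'
    simp only [Matrix.sum_apply, Matrix.mul_apply, conjTranspose_apply, Matrix.of_apply]
    rw [Finset.sum_eq_single (x - d (T x)), Finset.sum_eq_single (T x)]
    · by_cases hxx : x = x'
      · subst hxx; simp
      · rw [Matrix.one_apply_ne hxx, if_neg (c := T x = T x' ∧ _), mul_zero]
        rintro ⟨h1, h2⟩
        rw [← h1] at h2
        exact hxx (sub_left_injective h2)
    · intro s _ hs; simp [hs]
    · simp
    · intro y _ hy; simp [hy]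
    · simp
  · intro y z
    ext s t
    simp only [Matrix.mul_apply, Matrix.of_apply, hslice, Matrix.smul_apply, smul_eq_mul]
    simp only [Finset.mul_sum, Finset.sum_mul]
    rw [Finset.sum_comm]
    refine Finset.sum_congr rfl fun r _ => ?_
    rw [Finset.sum_eq_single (d t + π (r ᵥ* G))]
    · have h1 : T (d t + π (r ᵥ* G)) = t := by rw [map_add, hTd, hTg, add_zero]
      rw [h1, add_sub_cancel_left]
      by_cases hst : s = t
      · subst hst
        have : (y = π (r ᵥ* G) ∧ z = fun p => (r ᵥ* G) p.1) ↔ glue A y z = r ᵥ* G := by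
          rw [glue_eq_iff]; rfl
        simp only [← this]
        by_cases h2 : y = π (r ᵥ* G) <;> simp [h2]
      · simp [hst]
    · intro x _ hx; simp [hx]
    · simp
  · rw [← Fintype.sum_prod_type' (f := fun y z => (c * ∑ r : κ₁ → F,
      if glue A y z = r ᵥ* G then 1 else 0) * star (c * ∑ r : κ₁ → F,
      if glue A y z = r ᵥ* G then 1 else 0))]
    have := Equiv.sum_comp (Equiv.piEquivPiSubtypeProd (fun p => p ∈ A) (fun _ => F)).symm
      (fun x => (c * ∑ r : κ₁ → F, if x = r ᵥ* G then (1 : ℂ) else 0) *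
        star (c * ∑ r : κ₁ → F, if x = r ᵥ* G then (1 : ℂ) else 0))
    refine this.trans ?_
    -- By injectivity of `r ↦ r ᵥ* G`, each inner sum is `0` or `1` and so equals its square.
    have hsq : ∀ x : P → F, (c * ∑ r : κ₁ → F, if x = r ᵥ* G then (1 : ℂ) else 0) *
        star (c * ∑ r : κ₁ → F, if x = r ᵥ* G then (1 : ℂ) else 0) =
        c * star c * ∑ r : κ₁ → F, if x = r ᵥ* G then (1 : ℂ) else 0 := by
      intro x
      by_cases hx : ∃ r, x = r ᵥ* G
      · obtain ⟨r, rfl⟩ := hx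
        have : ∑ r' : κ₁ → F, (if r ᵥ* G = r' ᵥ* G then (1 : ℂ) else 0) = 1 := by
          simp [hG.eq_iff]
        simp [this]
      · push Not at hx
        simp [hx]
    simp only [hsq, ← Finset.mul_sum]
    rw [Finset.sum_comm]
    simpa using hcc

theorem isAuthorized_cssEncoder_iff (hG : Function.Injective fun r : κ₁ → F => r ᵥ* G)
    {A : Finset P} : IsAuthorized (cssEncoder D G) A ↔
      (∀ s r, (∀ p ∈ A, (s ᵥ* D + r ᵥ* G) p = 0) → s = 0) ∧
        ∀ s, ∃ r, ∀ p ∉ A, (s ᵥ* D + r ᵥ* G) p = 0 :=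
  ⟨fun h => h.cssEncoder_conditions, fun h => isAuthorized_cssEncoder hG h.1 h.2⟩
end

/-! ## Row spaces, dual codes and minimum distances -/

theorem mem_rowSpan_iff {F κ ι : Type*} [Field F] [Fintype κ] {G : Matrix κ ι F} {x : ι → F} :
    x ∈ rowSpan G ↔ ∃ r, r ᵥ* G = x := by
  rw [rowSpan, ← range_vecMulLinear]
  rfl

theorem rowSpan_fromRows {F κ κ' ι : Type*} [Field F] (G : Matrix κ ι F) (G' : Matrix κ' ι F) :
    rowSpan (fromRows G G') = rowSpan G ⊔ rowSpan G' := by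
  rw [rowSpan, rowSpan, rowSpan, ← Submodule.span_union]
  exact congrArg _ (Set.Sum.elim_range G G')

theorem IsGeneratorMatrix.vecMul_injective {F κ ι : Type*} [Field F] [Fintype κ]
    {G : Matrix κ ι F} {C : Submodule F (ι → F)} (h : IsGeneratorMatrix G C) :
    Function.Injective fun r : κ → F => r ᵥ* G :=
  vecMul_injective_iff.2 h.1

theorem IsGeneratorMatrix.mem_iff {F κ ι : Type*} [Field F] [Fintype κ]
    {G : Matrix κ ι F} {C : Submodule F (ι → F)} (h : IsGeneratorMatrix G C) {x : ι → F} :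
    x ∈ C ↔ ∃ r, r ᵥ* G = x := by
  rw [← h.2, mem_rowSpan_iff]

theorem dualCode_le_dualCode_iff {F ι : Type*} [Field F] [Fintype ι] [DecidableEq ι]
    {C C' : Submodule F (ι → F)} : dualCode C ≤ dualCode C' ↔ C' ≤ C := by
  refine ⟨fun h x hx => ?_, fun h x hx c hc => hx c (h hc)⟩
  by_contra hxC
  -- A functional that separates `x` from `C` is a dot product with some word, which then lies in
  -- `dualCode C`.
  obtain ⟨f, hfx, hf⟩ := Submodule.exists_le_ker_of_notMem hxC
  have hfd : ∀ y, (fun i => f (Pi.single i 1)) ⬝ᵥ y = f y := by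
    intro y
    conv_rhs => rw [pi_eq_sum_univ' y, map_sum]
    simp only [map_smul, dotProduct, smul_eq_mul, mul_comm]
  exact hfx ((hfd x).symm.trans (h (fun c hc => (hfd c).trans (hf hc)) x hx))

theorem dualCode_sup {F ι : Type*} [Field F] [Fintype ι] (C C' : Submodule F (ι → F)) :
    dualCode (C ⊔ C') = dualCode C ⊓ dualCode C' := by
  refine le_antisymm (fun x hx => ⟨fun c hc => hx c (Submodule.mem_sup_left hc),
    fun c hc => hx c (Submodule.mem_sup_right hc)⟩) fun x hx c hc => ?_
  obtain ⟨y, hy, z, hz, rfl⟩ := Submodule.mem_sup.1 hc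
  rw [dotProduct_add, hx.1 y hy, hx.2 z hz, add_zero]

/-- The words whose support is contained in `J`. -/
def supportedOn (F : Type*) {ι : Type*} [Field F] (J : Finset ι) : Submodule F (ι → F) :=
  Submodule.pi {i | i ∉ J} fun _ => ⊥

theorem mem_supportedOn {F ι : Type*} [Field F] {J : Finset ι} {x : ι → F} :
    x ∈ supportedOn F J ↔ ∀ i ∉ J, x i = 0 := by
  simp [supportedOn, Submodule.mem_pi]

theorem mem_dualCode_supportedOn {F ι : Type*} [Field F] [Fintype ι] [DecidableEq ι]
    {J : Finset ι} {x : ι → F} : x ∈ dualCode (supportedOn F J) ↔ ∀ i ∈ J, x i = 0 := by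
  refine ⟨fun h i hi => ?_, fun h c hc => Finset.sum_eq_zero fun i _ => ?_⟩
  · have := h (Pi.single i 1) (mem_supportedOn.2 fun j hj =>
      Pi.single_eq_of_ne (by rintro rfl; exact hj hi) 1)
    simpa using this
  · by_cases hi : i ∈ J
    · rw [h i hi, zero_mul]
    · rw [mem_supportedOn.1 hc i hi, mul_zero]

theorem lt_relMinDist_iff {F ι : Type*} [Field F] [DecidableEq F] [Fintype ι]
    {C₀ C₁ : Submodule F (ι → F)} (h : ¬ C₀ ≤ C₁) {k : ℕ} :
    k < relMinDist C₀ C₁ ↔ ∀ c ∈ C₀, hammingNorm c ≤ k → c ∈ C₁ := by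
  obtain ⟨⟨c, hc, hc1, hcw⟩, hmin⟩ := relMinDist_isLeast h
  constructor
  · intro hk d hd hdk
    by_contra hd1
    have := hmin ⟨d, hd, hd1, rfl⟩
    omega
  · intro hk
    by_contra hlt
    exact hc1 (hk c hc (by omega))

/-- A word vanishes on some set of `τ` positions exactly when its weight is at most `n - τ`. -/
theorem forall_card_eq_iff_lt_relMinDist {F : Type*} [Field F] [DecidableEq F] {n τ : ℕ}
    (hτ : τ ≤ n) {C₀ C₁ : Submodule F (Fin n → F)} (h : ¬ C₀ ≤ C₁) :
    (∀ J : Finset (Fin n), J.card = τ → ∀ c ∈ C₀, (∀ i ∈ J, c i = 0) → c ∈ C₁) ↔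
      n - τ < relMinDist C₀ C₁ := by
  have hcard : ∀ c : Fin n → F, hammingNorm c + (Finset.univ.filter fun i => c i = 0).card = n := by
    intro c
    have := Finset.card_filter_add_card_filter_not (s := (Finset.univ : Finset (Fin n)))
      (fun i => c i ≠ 0)
    simpa [hammingNorm] using this
  rw [lt_relMinDist_iff h]
  constructor
  · intro hJ c hc hw
    obtain ⟨J, hJs, hJc⟩ := Finset.exists_subset_card_eq
      (s := Finset.univ.filter fun i => c i = 0) (n := τ) (by have := hcard c; omega)
    exact hJ J hJc c hc fun i hi => (Finset.mem_filter.1 (hJs hi)).2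
  · intro hw J hJ c hc hcJ
    refine hw c hc ?_
    have : J.card ≤ (Finset.univ.filter fun i => c i = 0).card :=
      Finset.card_le_card fun i hi => Finset.mem_filter.2 ⟨Finset.mem_univ i, hcJ i hi⟩
    have := hcard c
    omega

theorem relMinDist_pos {F ι : Type*} [Field F] [DecidableEq F] [Fintype ι]
    {C₀ C₁ : Submodule F (ι → F)} (h : ¬ C₀ ≤ C₁) : 0 < relMinDist C₀ C₁ :=
  (lt_relMinDist_iff h).2 fun c _ hc => by
    rw [hammingNorm_eq_zero.1 (Nat.le_zero.1 hc)]
    exact C₁.zero_mem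

/-! ## Authorized sets of extended CSS codes -/

section
variable {F : Type*} [Field F] {n u v m f₁ : ℕ}
  {F₀ F₁ : Submodule F (Fin n → F)}
  {GU : Matrix (Fin u) (Fin n) F} {GV : Matrix (Fin v) (Fin n) F}
  {D : Matrix (Fin m) (Fin n) F} {G₁ : Matrix (Fin f₁) (Fin n) F}

theorem vecMul_fromCols_add_vecMul_fromBlocks (s : Fin m → F) (r₁ : Fin f₁ → F)
    (a : Fin u → F) (b : Fin v → F) :
    s ᵥ* fromCols D (0 : Matrix (Fin m) (Fin u ⊕ Fin v) F) +
        Sum.elim r₁ (Sum.elim a b) ᵥ* fromBlocks G₁ 0 (fromRows GU GV) 1 =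
      Sum.elim (s ᵥ* D + (r₁ ᵥ* G₁ + (a ᵥ* GU + b ᵥ* GV))) (Sum.elim a b) := by
  rw [vecMul_fromCols, vecMul_fromBlocks, Sum.elim_comp_inl, Sum.elim_comp_inr, sumElim_vecMul_fromRows, vecMul_zero, vecMul_zero,
    vecMul_one, zero_add]
  ext (i | i) <;> simp

theorem vecMul_fromBlocks_one_injective (hG₁ : IsGeneratorMatrix G₁ F₁) :
    Function.Injective fun r : Fin f₁ ⊕ (Fin u ⊕ Fin v) → F =>
      r ᵥ* (fromBlocks G₁ 0 (fromRows GU GV) 1 :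
        Matrix (Fin f₁ ⊕ (Fin u ⊕ Fin v)) (Fin n ⊕ (Fin u ⊕ Fin v)) F) := by
  refine (injective_iff_map_eq_zero
    (fromBlocks G₁ 0 (fromRows GU GV) 1 :
      Matrix (Fin f₁ ⊕ (Fin u ⊕ Fin v)) (Fin n ⊕ (Fin u ⊕ Fin v)) F).vecMulLinear).2 fun r hr => ?_
  obtain ⟨r₁, r₂, rfl⟩ : ∃ r₁ r₂, r = Sum.elim r₁ r₂ :=
    ⟨_, _, (Sum.elim_comp_inl_inr r).symm⟩
  rw [vecMulLinear_apply, vecMul_fromBlocks, vecMul_zero, vecMul_one, zero_add] at hr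
  -- The identity block displays `r₂`, so `G_E` may have dependent rows.
  have h2 : r₂ = 0 := funext fun i => congrFun hr (Sum.inr i)
  subst h2
  have h1 : r₁ ᵥ* G₁ = 0 ᵥ* G₁ := by
    ext i
    simpa using congrFun hr (Sum.inl i)
  rw [hG₁.vecMul_injective h1]
  exact Sum.elim_zero_zero

theorem bit_condition_iff (hN2 : F₀ ⊓ rowSpan (fromRows GU GV) = ⊥)
    (hD : IsQuotientGeneratorMatrix D F₀ F₁) (hG₁ : IsGeneratorMatrix G₁ F₁)
    (J : Finset (Fin n)) :
    (∀ (s : Fin m → F) (r : Fin f₁ ⊕ (Fin u ⊕ Fin v) → F), (∀ p ∈ withExtension (u := u) (v := v) J,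
      (s ᵥ* fromCols D (0 : Matrix (Fin m) (Fin u ⊕ Fin v) F) +
        r ᵥ* fromBlocks G₁ 0 (fromRows GU GV) 1 : Fin n ⊕ (Fin u ⊕ Fin v) → F) p = 0) → s = 0) ↔
      ∀ c ∈ F₀ ⊔ rowSpan GV, (∀ i ∈ J, c i = 0) → c ∈ F₁ ⊔ rowSpan GV := by
  obtain ⟨W, hW, hWF, rfl⟩ := hD
  rw [rowSpan_fromRows] at hN2
  constructor
  · intro h c hc hcJ
    obtain ⟨f, hf, w, hw, rfl⟩ := Submodule.mem_sup.1 hc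
    obtain ⟨x, hx, y, hy, rfl⟩ := Submodule.mem_sup.1 hf
    obtain ⟨s, rfl⟩ := hW.mem_iff.1 hx
    obtain ⟨r, rfl⟩ := hG₁.mem_iff.1 hy
    obtain ⟨b, rfl⟩ := mem_rowSpan_iff.1 hw
    have hs : s = 0 := by
      refine h s (Sum.elim r (Sum.elim 0 b)) fun p hp => ?_
      rw [vecMul_fromCols_add_vecMul_fromBlocks]
      rcases p with i | i | i
      · simpa [add_assoc] using hcJ i (by simpa [withExtension] using hp)
      · rfl
      · simp [withExtension] at hp
    rw [hs, zero_vecMul, zero_add]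
    exact Submodule.add_mem_sup hy hw
  · intro h s r hr
    obtain ⟨r₁, a, b, rfl⟩ : ∃ r₁ a b, r = Sum.elim r₁ (Sum.elim a b) :=
      ⟨r ∘ Sum.inl, r ∘ Sum.inr ∘ Sum.inl, r ∘ Sum.inr ∘ Sum.inr, by ext (i | i | i) <;> rfl⟩
    rw [vecMul_fromCols_add_vecMul_fromBlocks] at hr
    have ha : a = 0 := funext fun i => hr (Sum.inr (Sum.inl i)) (by simp [withExtension])
    subst ha
    have hsW : s ᵥ* D ∈ W := hW.mem_iff.2 ⟨s, rfl⟩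
    have hr₁ : r₁ ᵥ* G₁ ∈ F₁ := hG₁.mem_iff.2 ⟨r₁, rfl⟩
    have hb : b ᵥ* GV ∈ rowSpan GV := mem_rowSpan_iff.2 ⟨b, rfl⟩
    have := h (s ᵥ* D + r₁ ᵥ* G₁ + b ᵥ* GV)
      (Submodule.add_mem_sup (Submodule.add_mem_sup hsW hr₁) hb) (fun i hi => by
        simpa [add_assoc] using hr (Sum.inl i) (by simpa [withExtension] using hi))
    obtain ⟨f, hf, w, hw, hfw⟩ := Submodule.mem_sup.1 this
    have he : s ᵥ* D + r₁ ᵥ* G₁ - f = w - b ᵥ* GV := by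
      rw [sub_eq_sub_iff_add_eq_add, ← hfw, add_comm]
    -- The difference lies in both `F₀` and `E`, which meet trivially.
    have hz : s ᵥ* D + r₁ ᵥ* G₁ - f = 0 := by
      rw [← Submodule.mem_bot F, ← hN2]
      refine ⟨sub_mem (Submodule.add_mem_sup hsW hr₁) (Submodule.mem_sup_right hf), ?_⟩
      rw [he]
      exact Submodule.mem_sup_right (sub_mem hw hb)
    have hsF : s ᵥ* D ∈ F₁ := by
      rw [add_sub_assoc, add_eq_zero_iff_eq_neg] at hz
      rw [hz]
      exact neg_mem (sub_mem hr₁ hf)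
    have hs0 : s ᵥ* D = 0 := by
      rw [← Submodule.mem_bot F, ← hWF]
      exact ⟨hsW, hsF⟩
    exact hW.vecMul_injective (hs0.trans (zero_vecMul D).symm)

theorem phase_condition_iff (hD : IsQuotientGeneratorMatrix D F₀ F₁) (hG₁ : IsGeneratorMatrix G₁ F₁)
    (J : Finset (Fin n)) :
    (∀ s : Fin m → F, ∃ r : Fin f₁ ⊕ (Fin u ⊕ Fin v) → F, ∀ p ∉ withExtension (u := u) (v := v) J,
      (s ᵥ* fromCols D (0 : Matrix (Fin m) (Fin u ⊕ Fin v) F) +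
        r ᵥ* fromBlocks G₁ 0 (fromRows GU GV) 1 : Fin n ⊕ (Fin u ⊕ Fin v) → F) p = 0) ↔
      ∀ c ∈ dualCode (F₁ ⊔ rowSpan GU), (∀ i ∈ J, c i = 0) → c ∈ dualCode (F₀ ⊔ rowSpan GU) := by
  obtain ⟨W, hW, hWF, rfl⟩ := hD
  -- Vanishing on `J` is duality to the words supported on `J`; dualizing turns the claim into a
  -- decomposition of `W`.
  have hdual : (∀ c ∈ dualCode (F₁ ⊔ rowSpan GU), (∀ i ∈ J, c i = 0) →
      c ∈ dualCode (W ⊔ F₁ ⊔ rowSpan GU)) ↔ W ≤ F₁ ⊔ rowSpan GU ⊔ supportedOn F J := by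
    trans dualCode (F₁ ⊔ rowSpan GU ⊔ supportedOn F J) ≤ dualCode (W ⊔ F₁ ⊔ rowSpan GU)
    · rw [dualCode_sup _ (supportedOn F J)]
      exact ⟨fun h c hc => h c hc.1 (mem_dualCode_supportedOn.1 hc.2),
        fun h c hc hcJ => h ⟨hc, mem_dualCode_supportedOn.2 hcJ⟩⟩
    · rw [dualCode_le_dualCode_iff, sup_assoc W, sup_le_iff]
      exact and_iff_left le_sup_left
  rw [hdual]
  constructor
  · intro h x hx
    obtain ⟨s, rfl⟩ := hW.mem_iff.1 hx
    obtain ⟨r, hr⟩ := h s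
    obtain ⟨r₁, a, b, rfl⟩ : ∃ r₁ a b, r = Sum.elim r₁ (Sum.elim a b) :=
      ⟨r ∘ Sum.inl, r ∘ Sum.inr ∘ Sum.inl, r ∘ Sum.inr ∘ Sum.inr, by ext (i | i | i) <;> rfl⟩
    rw [vecMul_fromCols_add_vecMul_fromBlocks] at hr
    have hb : b = 0 := funext fun i => hr (Sum.inr (Sum.inr i)) (by simp [withExtension])
    subst hb
    have hk : r₁ ᵥ* G₁ + a ᵥ* GU ∈ F₁ ⊔ rowSpan GU :=
      Submodule.add_mem_sup (hG₁.mem_iff.2 ⟨r₁, rfl⟩) (mem_rowSpan_iff.2 ⟨a, rfl⟩)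
    have hsupp : s ᵥ* D + (r₁ ᵥ* G₁ + a ᵥ* GU) ∈ supportedOn F J :=
      mem_supportedOn.2 fun i hi => by
        simpa using hr (Sum.inl i) (by simpa [withExtension] using hi)
    have : s ᵥ* D = -(r₁ ᵥ* G₁ + a ᵥ* GU) + (s ᵥ* D + (r₁ ᵥ* G₁ + a ᵥ* GU)) := by abel
    rw [this]
    exact Submodule.add_mem_sup (neg_mem hk) hsupp
  · intro h s
    obtain ⟨y, hy, x, hx, hyx⟩ := Submodule.mem_sup.1 (h (hW.mem_iff.2 ⟨s, rfl⟩))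
    obtain ⟨f, hf, w, hw, rfl⟩ := Submodule.mem_sup.1 hy
    obtain ⟨r, rfl⟩ := hG₁.mem_iff.1 hf
    obtain ⟨a, rfl⟩ := mem_rowSpan_iff.1 hw
    refine ⟨Sum.elim (-r) (Sum.elim (-a) 0), fun p hp => ?_⟩
    rw [vecMul_fromCols_add_vecMul_fromBlocks, ← hyx]
    rcases p with i | i | i
    · have hi := mem_supportedOn.1 hx i (by simpa [withExtension] using hp)
      simp only [neg_vecMul, zero_vecMul, Sum.elim_inl, Pi.add_apply, Pi.neg_apply, hi, Pi.zero_apply]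
      ring
    · simp [withExtension] at hp
    · rfl

theorem isAuthorized_ecssEncoder_iff [Fintype F] [DecidableEq F]
    (hN2 : F₀ ⊓ rowSpan (fromRows GU GV) = ⊥)
    (hD : IsQuotientGeneratorMatrix D F₀ F₁) (hG₁ : IsGeneratorMatrix G₁ F₁)
    (J : Finset (Fin n)) :
    IsAuthorized (ecssEncoder D G₁ (fromRows GU GV)) (withExtension J) ↔
      (∀ c ∈ F₀ ⊔ rowSpan GV, (∀ i ∈ J, c i = 0) → c ∈ F₁ ⊔ rowSpan GV) ∧
      ∀ c ∈ dualCode (F₁ ⊔ rowSpan GU), (∀ i ∈ J, c i = 0) → c ∈ dualCode (F₀ ⊔ rowSpan GU) := by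
  rw [ecssEncoder, isAuthorized_cssEncoder_iff (vecMul_fromBlocks_one_injective hG₁),
    bit_condition_iff hN2 hD hG₁, phase_condition_iff hD hG₁]

/-- Ensures that both minima in the threshold range over nonempty sets, so the default value `sInf ∅
= 0` never occurs. -/
theorem not_sup_le_sup_of_lt {X E : Submodule F (Fin n → F)} (hN1 : F₁ < F₀) (hE : F₀ ⊓ E = ⊥)
    (hX : X ≤ E) : ¬ F₀ ⊔ X ≤ F₁ ⊔ X := by
  intro h
  refine hN1.not_ge fun f hf => ?_
  obtain ⟨g, hg, x, hx, rfl⟩ := Submodule.mem_sup.1 (h (Submodule.mem_sup_left hf))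
  have hx0 : x = 0 := by
    rw [← Submodule.mem_bot F, ← hE]
    refine ⟨?_, hX hx⟩
    simpa using sub_mem hf (hN1.le hg)
  rwa [hx0, add_zero]
end

theorem mainTheorem6 {F : Type*} [Field F] [Fintype F] [DecidableEq F]
    {n u v m f₁ : ℕ}
    (F₀ F₁ : Submodule F (Fin n → F))
    (GU : Matrix (Fin u) (Fin n) F) (GV : Matrix (Fin v) (Fin n) F)
    (hN1 : F₁ < F₀)
    (hN2 : F₀ ⊓ rowSpan (Matrix.fromRows GU GV) = ⊥)
    (D : Matrix (Fin m) (Fin n) F) (hD : IsQuotientGeneratorMatrix D F₀ F₁)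
    (G₁ : Matrix (Fin f₁) (Fin n) F) (hG₁ : IsGeneratorMatrix G₁ F₁)
    (τ : ℕ) :
    (∀ J : Finset (Fin n), J.card = τ →
        IsAuthorized (ecssEncoder D G₁ (Matrix.fromRows GU GV)) (withExtension J)) ↔
      ecssThreshold F₀ F₁ (rowSpan GU) (rowSpan GV) ≤ (τ : ℤ) := by
  have hV : ¬ F₀ ⊔ rowSpan GV ≤ F₁ ⊔ rowSpan GV := not_sup_le_sup_of_lt hN1 hN2
    (by rw [rowSpan_fromRows]; exact le_sup_right)
  have hU : ¬ dualCode (F₁ ⊔ rowSpan GU) ≤ dualCode (F₀ ⊔ rowSpan GU) := by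
    rw [dualCode_le_dualCode_iff]
    exact not_sup_le_sup_of_lt hN1 hN2 (by rw [rowSpan_fromRows]; exact le_sup_left)
  have hpV := relMinDist_pos hV
  have hpU := relMinDist_pos hU
  rw [ecssThreshold]
  rcases le_or_gt τ n with hτ | hτ
  · simp only [isAuthorized_ecssEncoder_iff hN2 hD hG₁, forall_and]
    rw [forall_card_eq_iff_lt_relMinDist hτ hV, forall_card_eq_iff_lt_relMinDist hτ hU]
    omega
  -- For `τ > n` no `J` exists, and both distances are positive, so the threshold is at most `n`.
  · refine iff_of_true (fun J hJ => ?_) (by omega)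
    have := J.card_le_univ
    rw [Fintype.card_fin] at this
    omega
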